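/- Let $n,m\ge 0$ be integers. Let $Q_0,\dots,Q_m$ be real symmetric $n\times n$ matrices, $c_0,\dots,c_m\in\mathbb R^n$, $b\in\mathbb R^m$, and $\ell,u\in\mathbb R^n$ with $\ell\ge 0$. Write $\langle A,B\rangle=\sum_{i,j}a_{ij}b_{ij}$ and let $$(P)\quad \min\{\langle Q_0,xx^T\rangle+c_0^Tx \;:\; \langle Q_r,xx^T\rangle+c_r^Tx\le b_r\ (r=1,\dots,m),\ \ell_i\le x_i\le u_i\ (i=1,\dots,n)\},$$ whose feasible set is assumed to be non-empty. For $x\in\mathbb R^n$, a symmetric matrix $Y\in\mathbb R^{n\times n}$ and $i\le j$, the McCormick inequalities $h^t_{ij}(x,Y)\le 0$, $t=1,\dots,4$, are $$Y_{ij}-u_jx_i-\ell_ix_j+u_j\ell_i\le 0,\qquad Y_{ij}-u_ix_j-\ell_jx_i+u_i\ell_j\le 0,$$ $$-Y_{ij}+u_jx_i+u_ix_j-u_iu_j\le 0,\qquad -Y_{ij}+\ell_jx_i+\ell_ix_j-\ell_i\ell_j\le 0.$$ For $i<j<k$ the general triangle inequalities $h'^t_{ijk}(x,Y)\le 0$,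 $t=1,\dots,12$, are 1. $(\ell_k-u_k)Y_{ij}+(\ell_j-u_j)Y_{ik}-u_iY_{jk}+u_iu_kx_j+(u_ju_k-\ell_j\ell_k)x_i+u_iu_jx_k-u_iu_ju_k\le 0$ 2. $(\ell_k-u_k)Y_{ij}-u_jY_{ik}+(\ell_i-u_i)Y_{jk}+(u_iu_k-\ell_i\ell_k)x_j+u_ju_kx_i+u_iu_jx_k-u_iu_ju_k\le 0$ 3. $-u_kY_{ij}+(\ell_j-u_j)Y_{ik}+(\ell_i-u_i)Y_{jk}+u_iu_kx_j+u_ju_kx_i+(u_iu_j-\ell_i\ell_j)x_k-u_iu_ju_k\le 0$ 4. $(u_j-\ell_j)Y_{ik}+(\ell_k-u_k)Y_{ij}+u_iY_{jk}+(\ell_ju_k-u_j\ell_k)x_i-u_i\ell_kx_j-u_iu_jx_k+u_iu_j\ell_k\le 0$ 5. $u_jY_{ik}+(\ell_k-u_k)Y_{ij}+(u_i-\ell_i)Y_{jk}-u_j\ell_kx_i+(\ell_iu_k-u_i\ell_k)x_j-u_iu_jx_k+u_iu_j\ell_k\le 0$ 6. $(u_k-\ell_k)Y_{ij}+u_iY_{jk}+(\ell_j-u_j)Y_{ik}-u_iu_kx_j+(u_j\ell_k-\ell_ju_k)x_i-u_i\ell_jx_k+u_i\ell_ju_k\le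 0$ 7. $u_kY_{ij}+(u_i-\ell_i)Y_{jk}+(\ell_j-u_j)Y_{ik}-u_iu_kx_j-\ell_ju_kx_i+(\ell_iu_j-u_i\ell_j)x_k+u_i\ell_ju_k\le 0$ 8. $(u_k-\ell_k)Y_{ij}+(\ell_i-u_i)Y_{jk}+u_jY_{ik}+(u_i\ell_k-\ell_iu_k)x_j-u_ju_kx_i-\ell_iu_jx_k+\ell_iu_ju_k\le 0$ 9. $u_kY_{ij}+(\ell_i-u_i)Y_{jk}+(u_j-\ell_j)Y_{ik}-\ell_iu_kx_j-u_ju_kx_i+(u_i\ell_j-\ell_iu_j)x_k+\ell_iu_ju_k\le 0$ 10. $-u_iY_{jk}+(u_j-\ell_j)Y_{ik}+(u_k-\ell_k)Y_{ij}+u_i\ell_kx_j+(\ell_j\ell_k-u_ju_k)x_i+u_i\ell_jx_k-u_i\ell_j\ell_k\le 0$ 11. $(u_i-\ell_i)Y_{jk}-u_jY_{ik}+(u_k-\ell_k)Y_{ij}+(\ell_i\ell_k-u_iu_k)x_j+u_j\ell_kx_i+\ell_iu_jx_k-\ell_iu_j\ell_k\le 0$ 12. $-u_kY_{ij}+(u_i-\ell_i)Y_{jk}+(u_j-\ell_j)Y_{ik}+\ell_iu_kx_j+\ell_ju_kx_i+(\ell_i\ell_j-u_iu_j)x_k-\ell_i\ell_ju_k\le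 0$ For positive semidefinite matrices $S_0,\dots,S_m\in\mathbb R^{n\times n}$ let $v(P'_{S_0,\dots,S_m})$ be the optimal value of $$(P'_{S_0,\dots,S_m})\quad \min\ \langle S_0,xx^T\rangle+c_0^Tx+\langle Q_0-S_0,Y\rangle$$ over $x\in\mathbb R^n$ and $Y\in\mathbb R^{n\times n}$ subject to $\ell\le x\le u$; $\langle S_r,xx^T\rangle+c_r^Tx+\langle Q_r-S_r,Y\rangle\le b_r$ for $r=1,\dots,m$; the McCormick inequalities for all $i\le j$; the general triangle inequalities for all $i<j<k$; and $Y_{ji}=Y_{ij}$ for all $i<j$. Let $$v(OPT)=\sup_{S_0,\dots,S_m\succeq 0} v(P'_{S_0,\dots,S_m}).$$ Let $v(SDP)$ be the optimal value of the "Shor plus RLT plus Triangle" relaxation $$(SDP)\quad \min\ \langle Q_0,X\rangle+c_0^Tx$$ over $x\in\mathbb R^n$ and symmetric $X\in\mathbb R^{n\times n}$ subject to $\langle Q_r,X\rangle+c_r^Tx\le b_r$ for $r=1,\dots,m$; the inequalities $$X_{ii}-u_ix_i-\ell_ix_i+u_i\ell_i\le 0,\qquad -X_{ii}+2u_ix_i-u_i^2\le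 0,\qquad -X_{ii}+2\ell_ix_i-\ell_i^2\le 0$$ for all $i$; $\begin{pmatrix}1&x^T\\x&X\end{pmatrix}\succeq 0$; the McCormick inequalities $h^t_{ij}(x,X)\le 0$ for all $i<j$; and the general triangle inequalities $h'^t_{ijk}(x,X)\le 0$ for all $i<j<k$. (Optimal values of minimization problems are infima, in the extended reals.) Then $v(OPT)=v(SDP)$. -/

import Mathlib

open scoped Matrix

/-- The data of a quadratically constrained quadratic program `(P)` with `n` variables and `m`
constraints: minimize `⟨Q 0, x xᵀ⟩ + (c 0)ᵀ x` subject to `⟨Q r, x xᵀ⟩ + (c r)ᵀ x ≤ b r` for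
`r = 1, …, m`, and `l i ≤ x i ≤ u i`. The indices of `Q` and `c` run over `{0, 1, …, m}`;
the constraint with index `r : Fin m` of `b` is the one with index `r.succ` of `Q` and `c`. -/
structure QCQP (n m : ℕ) where
  Q : Fin (m + 1) → Matrix (Fin n) (Fin n) ℝ
  c : Fin (m + 1) → Fin n → ℝ
  b : Fin m → ℝ
  l : Fin n → ℝ
  u : Fin n → ℝ

namespace QCQP

variable {n m : ℕ}

/-- The inner product `⟨A, B⟩ = ∑ i, ∑ j, a i j * b i j` of matrices. -/
def frob (A B : Matrix (Fin n) (Fin n) ℝ) : ℝ := ∑ i, ∑ j, A i j * B i j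

/-- `x xᵀ`. -/
def outer (x : Fin n → ℝ) : Matrix (Fin n) (Fin n) ℝ := Matrix.vecMulVec x x

/-- The quadratic function `f_r(x) = ⟨Q r, x xᵀ⟩ + (c r)ᵀ x`. -/
def f (P : QCQP n m) (r : Fin (m + 1)) (x : Fin n → ℝ) : ℝ :=
  frob (P.Q r) (outer x) + P.c r ⬝ᵥ x

/-- The feasible set of `(P)`. -/
def feasible (P : QCQP n m) : Set (Fin n → ℝ) :=
  {x | (∀ r : Fin m, P.f r.succ x ≤ P.b r) ∧ ∀ i, P.l i ≤ x i ∧ x i ≤ P.u i}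

/-- The left-hand sides of the four McCormick inequalities `h^t_{ij}(x, Y) ≤ 0`. -/
def mcCormick (P : QCQP n m) (x : Fin n → ℝ) (Y : Matrix (Fin n) (Fin n) ℝ)
    (i j : Fin n) : Fin 4 → ℝ :=
  let l := P.l
  let u := P.u
  ![Y i j - u j * x i - l i * x j + u j * l i,
    Y i j - u i * x j - l j * x i + u i * l j,
    -Y i j + u j * x i + u i * x j - u i * u j,
    -Y i j + l j * x i + l i * x j - l i * l j]

/-- The left-hand sides of the twelve general triangle inequalities `h'^t_{ijk}(x, Y) ≤ 0`. -/
def triangle (P : QCQP n m) (x : Fin n → ℝ) (Y : Matrix (Fin n) (Fin n) ℝ)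
    (i j k : Fin n) : Fin 12 → ℝ :=
  let l := P.l
  let u := P.u
  ![(l k - u k) * Y i j + (l j - u j) * Y i k - u i * Y j k
      + u i * u k * x j + (u j * u k - l j * l k) * x i + u i * u j * x k - u i * u j * u k,
    (l k - u k) * Y i j - u j * Y i k + (l i - u i) * Y j k
      + (u i * u k - l i * l k) * x j + u j * u k * x i + u i * u j * x k - u i * u j * u k,
    -u k * Y i j + (l j - u j) * Y i k + (l i - u i) * Y j k
      + u i * u k * x j + u j * u k * x i + (u i * u j - l i * l j) * x k - u i * u j * u k,
    (u j - l j) * Y i k + (l k - u k) * Y i j + u i * Y j k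
      + (l j * u k - u j * l k) * x i - u i * l k * x j - u i * u j * x k + u i * u j * l k,
    u j * Y i k + (l k - u k) * Y i j + (u i - l i) * Y j k
      - u j * l k * x i + (l i * u k - u i * l k) * x j - u i * u j * x k + u i * u j * l k,
    (u k - l k) * Y i j + u i * Y j k + (l j - u j) * Y i k
      - u i * u k * x j + (u j * l k - l j * u k) * x i - u i * l j * x k + u i * l j * u k,
    u k * Y i j + (u i - l i) * Y j k + (l j - u j) * Y i k
      - u i * u k * x j - l j * u k * x i + (l i * u j - u i * l j) * x k + u i * l j * u k,
    (u k - l k) * Y i j + (l i - u i) * Y j k + u j * Y i k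
      + (u i * l k - l i * u k) * x j - u j * u k * x i - l i * u j * x k + l i * u j * u k,
    u k * Y i j + (l i - u i) * Y j k + (u j - l j) * Y i k
      - l i * u k * x j - u j * u k * x i + (u i * l j - l i * u j) * x k + l i * u j * u k,
    -u i * Y j k + (u j - l j) * Y i k + (u k - l k) * Y i j
      + u i * l k * x j + (l j * l k - u j * u k) * x i + u i * l j * x k - u i * l j * l k,
    (u i - l i) * Y j k - u j * Y i k + (u k - l k) * Y i j
      + (l i * l k - u i * u k) * x j + u j * l k * x i + l i * u j * x k - l i * u j * l k,
    -u k * Y i j + (u i - l i) * Y j k + (u j - l j) * Y i k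
      + l i * u k * x j + l j * u k * x i + (l i * l j - u i * u j) * x k - l i * l j * u k]

/-- The convexified function `f_{r,S}(x, Y) = ⟨S, x xᵀ⟩ + (c r)ᵀ x + ⟨Q r - S, Y⟩`. -/
def convexified (P : QCQP n m) (r : Fin (m + 1)) (S : Matrix (Fin n) (Fin n) ℝ)
    (x : Fin n → ℝ) (Y : Matrix (Fin n) (Fin n) ℝ) : ℝ :=
  frob S (outer x) + P.c r ⬝ᵥ x + frob (P.Q r - S) Y

/-- The feasible set of the strengthened convex relaxation `(P'_{S_0, …, S_m})`. -/
def relaxFeasible (P : QCQP n m) (S : Fin (m + 1) → Matrix (Fin n) (Fin n) ℝ) :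
    Set ((Fin n → ℝ) × Matrix (Fin n) (Fin n) ℝ) :=
  {p | (∀ i, P.l i ≤ p.1 i ∧ p.1 i ≤ P.u i) ∧
    (∀ r : Fin m, P.convexified r.succ (S r.succ) p.1 p.2 ≤ P.b r) ∧
    (∀ i j, i ≤ j → ∀ t, P.mcCormick p.1 p.2 i j t ≤ 0) ∧
    (∀ i j k, i < j → j < k → ∀ t, P.triangle p.1 p.2 i j k t ≤ 0) ∧
    (∀ i j, i < j → p.2 j i = p.2 i j)}

/-- The optimal value `v(P'_{S_0, …, S_m})`, in the extended reals. -/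
noncomputable def vRelax (P : QCQP n m) (S : Fin (m + 1) → Matrix (Fin n) (Fin n) ℝ) : EReal :=
  ⨅ p ∈ P.relaxFeasible S, ((P.convexified 0 (S 0) p.1 p.2 : ℝ) : EReal)

/-- The optimal value `v(OPT)`: the supremum of `v(P'_{S_0, …, S_m})` over all tuples of positive
semidefinite matrices. -/
noncomputable def vOPT (P : QCQP n m) : EReal :=
  ⨆ S ∈ {S : Fin (m + 1) → Matrix (Fin n) (Fin n) ℝ | ∀ r, (S r).PosSemidef}, P.vRelax S

/-- The block matrix with rows `(1, xᵀ)` and `(x, X)`. -/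
def shorMatrix (x : Fin n → ℝ) (X : Matrix (Fin n) (Fin n) ℝ) :
    Matrix (Unit ⊕ Fin n) (Unit ⊕ Fin n) ℝ :=
  Matrix.fromBlocks 1 (Matrix.replicateRow Unit x) (Matrix.replicateCol Unit x) X

/-- The set `W` of the "Shor plus diagonal RLT" constraints. -/
def W (P : QCQP n m) : Set ((Fin n → ℝ) × Matrix (Fin n) (Fin n) ℝ) :=
  {p | (∀ r : Fin m, frob (P.Q r.succ) p.2 + P.c r.succ ⬝ᵥ p.1 ≤ P.b r) ∧
    (∀ i, p.2 i i - P.u i * p.1 i - P.l i * p.1 i + P.u i * P.l i ≤ 0) ∧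
    (∀ i, -p.2 i i + 2 * P.u i * p.1 i - P.u i ^ 2 ≤ 0) ∧
    (∀ i, -p.2 i i + 2 * P.l i * p.1 i - P.l i ^ 2 ≤ 0) ∧
    (shorMatrix p.1 p.2).PosSemidef ∧
    p.2.IsSymm}

/-- The feasible set of the "Shor plus RLT plus Triangle" semidefinite relaxation `(SDP)`. -/
def sdpFeasible (P : QCQP n m) : Set ((Fin n → ℝ) × Matrix (Fin n) (Fin n) ℝ) :=
  {p | p ∈ P.W ∧
    (∀ i j, i < j → ∀ t, P.mcCormick p.1 p.2 i j t ≤ 0) ∧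
    (∀ i j k, i < j → j < k → ∀ t, P.triangle p.1 p.2 i j k t ≤ 0)}

/-- The optimal value `v(SDP)`, in the extended reals. -/
noncomputable def vSDP (P : QCQP n m) : EReal :=
  ⨅ p ∈ P.sdpFeasible, ((frob (P.Q 0) p.2 + P.c 0 ⬝ᵥ p.1 : ℝ) : EReal)

end QCQP

/-! Writing `Y` for the lifted matrix, convexifying with `S` subtracts `⟨S, Y - xxᵀ⟩` from the
linearized function. At points of `(SDP)` the Schur complement gives `Y - xxᵀ ⪰ 0`, so this term is
nonnegative and every convexification is a lower bound (`vOPT_le_vSDP`).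

Conversely, convexifying the objective alone already suffices. The set `K = P.relaxFeasible 0` is
convex and, by the McCormick inequalities, compact. On `K` the supremum over `S ⪰ 0` of the
convexified objective is the SDP objective if `Y - xxᵀ ⪰ 0`, and `⊤` otherwise, so inf-sup dominates
`v(SDP)`. Sion's theorem exchanges inf and sup. Compactness of `K` replaces a Slater condition. -/

namespace QCQP

variable {n m : ℕ}

/-! ### Frobenius product -/

section Frobenius

variable (A B C : Matrix (Fin n) (Fin n) ℝ)

lemma frob_eq_trace : frob A B = (A * Bᵀ).trace := by
  simp [frob, Matrix.trace, Matrix.mul_apply]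

lemma frob_sub_left : frob (A - B) C = frob A C - frob B C := by
  simp [frob_eq_trace, Matrix.sub_mul]

lemma frob_sub_right : frob A (B - C) = frob A B - frob A C := by
  simp [frob_eq_trace, Matrix.mul_sub]

lemma frob_add_left : frob (A + B) C = frob A C + frob B C := by
  simp [frob_eq_trace, Matrix.add_mul]

lemma frob_add_right : frob A (B + C) = frob A B + frob A C := by
  simp [frob_eq_trace, Matrix.mul_add]

lemma frob_smul_left (a : ℝ) : frob (a • A) B = a * frob A B := by
  simp [frob_eq_trace]

lemma frob_smul_right (a : ℝ) : frob A (a • B) = a * frob A B := by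
  simp [frob_eq_trace]

@[simp] lemma frob_zero_left : frob 0 A = 0 := by
  simp [frob_eq_trace]

lemma frob_outer_left (v : Fin n → ℝ) : frob (outer v) A = v ⬝ᵥ (A *ᵥ v) := by
  simp only [frob, outer, Matrix.vecMulVec_apply, dotProduct, Matrix.mulVec, Finset.mul_sum]
  exact Finset.sum_congr rfl fun i _ => Finset.sum_congr rfl fun j _ => by ring

lemma frob_outer_right (v : Fin n → ℝ) : frob A (outer v) = v ⬝ᵥ (A *ᵥ v) := by
  rw [← frob_outer_left]
  exact Finset.sum_congr rfl fun i _ => Finset.sum_congr rfl fun j _ => mul_comm _ _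

variable {A B}

/-- The cone of positive semidefinite matrices is contained in its dual cone. -/
lemma frob_nonneg (hA : A.PosSemidef) (hB : B.PosSemidef) : 0 ≤ frob A B := by
  -- Schur product theorem, with the Hadamard product evaluated at the all-ones vector.
  simpa [frob, dotProduct, Matrix.mulVec] using
    (hA.hadamard hB).dotProduct_mulVec_nonneg (1 : Fin n → ℝ)

end Frobenius

lemma continuous_frob_right (A : Matrix (Fin n) (Fin n) ℝ) : Continuous (frob A) := by
  unfold frob; fun_prop

lemma continuous_frob_left (B : Matrix (Fin n) (Fin n) ℝ) : Continuous fun A => frob A B := by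
  unfold frob; fun_prop

lemma continuous_outer : Continuous (outer : (Fin n → ℝ) → Matrix (Fin n) (Fin n) ℝ) :=
  continuous_id.matrix_vecMulVec continuous_id

lemma posSemidef_outer (v : Fin n → ℝ) : (outer v).PosSemidef := by
  simpa [outer] using Matrix.posSemidef_vecMulVec_self_star v

/-- Schur complement of the corner entry of the Shor matrix. -/
lemma shorMatrix_posSemidef_iff (x : Fin n → ℝ) (X : Matrix (Fin n) (Fin n) ℝ) :
    (shorMatrix x X).PosSemidef ↔ (X - outer x).PosSemidef := by
  let _ : Invertible (1 : Matrix Unit Unit ℝ) := invertibleOne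
  have h := Matrix.PosDef.fromBlocks₁₁ (Matrix.replicateRow Unit x) X
    (Matrix.PosDef.one (n := Unit) (R := ℝ))
  have hrow : (Matrix.replicateRow Unit x)ᴴ = Matrix.replicateCol Unit x := by
    ext; simp
  have hmul : Matrix.replicateCol Unit x * Matrix.replicateRow Unit x = outer x := by
    rw [outer, Matrix.vecMulVec_eq Unit]
  rw [hrow, inv_one, Matrix.mul_one, hmul] at h
  exact h

/-- Isolates the dependence on `S`: a penalty, linear in `S`, on the gap `Y - xxᵀ`. -/
lemma convexified_eq (P : QCQP n m) (r : Fin (m + 1)) (S : Matrix (Fin n) (Fin n) ℝ)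
    (x : Fin n → ℝ) (Y : Matrix (Fin n) (Fin n) ℝ) :
    P.convexified r S x Y = frob (P.Q r) Y + P.c r ⬝ᵥ x - frob S (Y - outer x) := by
  rw [convexified, frob_sub_left, frob_sub_right]; ring

lemma isSymm_of_lt {Y : Matrix (Fin n) (Fin n) ℝ} (h : ∀ i j, i < j → Y j i = Y i j) :
    Y.IsSymm := by
  ext i j
  rcases lt_trichotomy i j with hij | rfl | hij
  · exact h i j hij
  · rfl
  · exact (h j i hij).symm

/-! ### Weak duality -/

/-- Every point feasible for the semidefinite relaxation is feasible for every convexification. -/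
lemma sdpFeasible_subset_relaxFeasible (P : QCQP n m) (hP : P.feasible.Nonempty)
    {S : Fin (m + 1) → Matrix (Fin n) (Fin n) ℝ} (hS : ∀ r, (S r).PosSemidef) :
    P.sdpFeasible ⊆ P.relaxFeasible S := by
  rintro ⟨x, X⟩ ⟨⟨hc, hd1, hd2, hd3, hX, hsymm⟩, hmc, htri⟩
  obtain ⟨y, -, hy⟩ := hP
  have hX' := (shorMatrix_posSemidef_iff x X).mp hX
  dsimp only at *
  refine ⟨fun i => ?_, fun r => ?_, fun i j hij t => ?_, htri, fun i j _ => hsymm.apply i j⟩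
  -- The SDP does not impose the box. It follows from `xᵢ² ≤ Xᵢᵢ` and the diagonal RLT inequality,
  -- given `lᵢ ≤ uᵢ`.
  · have hlu := (hy i).1.trans (hy i).2
    have hdiag : 0 ≤ X i i - x i * x i := by
      simpa [outer, Matrix.vecMulVec_apply] using hX'.diag_nonneg (i := i)
    have hprod : (x i - P.l i) * (x i - P.u i) ≤ 0 := by linarith [hd1 i]
    constructor <;> by_contra! hlt <;> nlinarith
  · rw [convexified_eq]
    linarith [hc r, frob_nonneg (hS r.succ) hX']
  · rcases hij.lt_or_eq with hij | rfl
    · exact hmc i j hij t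
    · have h1 := hd1 i
      have h2 := hd2 i
      have h3 := hd3 i
      fin_cases t <;> simp [mcCormick] <;> linarith

/-- Weak duality. -/
lemma vOPT_le_vSDP (P : QCQP n m) (hP : P.feasible.Nonempty) : P.vOPT ≤ P.vSDP := by
  refine iSup₂_le fun S hS => le_iInf₂ fun p hp => ?_
  refine (iInf₂_le p (sdpFeasible_subset_relaxFeasible P hP hS hp)).trans ?_
  rw [EReal.coe_le_coe_iff, convexified_eq]
  linarith [frob_nonneg (hS 0) ((shorMatrix_posSemidef_iff _ _).mp hp.1.2.2.2.2.1)]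

/-! ### The compact convex set for the minimax argument -/

section RelaxFeasibleZero

variable (P : QCQP n m)

lemma mem_relaxFeasible_zero_iff (p : (Fin n → ℝ) × Matrix (Fin n) (Fin n) ℝ) :
    p ∈ P.relaxFeasible 0 ↔ (∀ i, P.l i ≤ p.1 i ∧ p.1 i ≤ P.u i) ∧
      (∀ r : Fin m, frob (P.Q r.succ) p.2 + P.c r.succ ⬝ᵥ p.1 ≤ P.b r) ∧
      (∀ i j, i ≤ j → ∀ t, P.mcCormick p.1 p.2 i j t ≤ 0) ∧
      (∀ i j k, i < j → j < k → ∀ t, P.triangle p.1 p.2 i j k t ≤ 0) ∧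
      (∀ i j, i < j → p.2 j i = p.2 i j) := by
  simp [relaxFeasible, convexified_eq]

lemma mcCormick_affine (i j : Fin n) (t : Fin 4) {a b : ℝ} (hab : a + b = 1)
    (x y : Fin n → ℝ) (X Y : Matrix (Fin n) (Fin n) ℝ) :
    P.mcCormick (a • x + b • y) (a • X + b • Y) i j t =
      a * P.mcCormick x X i j t + b * P.mcCormick y Y i j t := by
  obtain rfl : b = 1 - a := by linarith
  fin_cases t <;> simp [mcCormick] <;> ring

lemma triangle_affine (i j k : Fin n) (t : Fin 12) {a b : ℝ} (hab : a + b = 1)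
    (x y : Fin n → ℝ) (X Y : Matrix (Fin n) (Fin n) ℝ) :
    P.triangle (a • x + b • y) (a • X + b • Y) i j k t =
      a * P.triangle x X i j k t + b * P.triangle y Y i j k t := by
  obtain rfl : b = 1 - a := by linarith
  fin_cases t <;> simp [triangle] <;> ring

lemma continuous_mcCormick (i j : Fin n) (t : Fin 4) :
    Continuous fun p : (Fin n → ℝ) × Matrix (Fin n) (Fin n) ℝ => P.mcCormick p.1 p.2 i j t := by
  fin_cases t <;> simp [mcCormick] <;> fun_prop

lemma continuous_triangle (i j k : Fin n) (t : Fin 12) :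
    Continuous fun p : (Fin n → ℝ) × Matrix (Fin n) (Fin n) ℝ =>
      P.triangle p.1 p.2 i j k t := by
  fin_cases t <;> simp [triangle] <;> fun_prop

/-- With `S = 0` every constraint is affine in `(x, Y)`. -/
lemma convex_relaxFeasible_zero : Convex ℝ (P.relaxFeasible 0) := by
  intro p hp q hq a b ha hb hab
  rw [mem_relaxFeasible_zero_iff] at *
  obtain ⟨p1, p2, p3, p4, p5⟩ := hp
  obtain ⟨q1, q2, q3, q4, q5⟩ := hq
  have key : ∀ {s t c : ℝ}, s ≤ c → t ≤ c → a * s + b * t ≤ c := fun {s t c} hs ht =>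
    (convex_Iic c) hs ht ha hb hab
  refine ⟨fun i => ?_, fun r => ?_, fun i j hij t => ?_, fun i j k hij hjk t => ?_,
    fun i j hij => ?_⟩
  · exact (convex_Icc (P.l i) (P.u i)) (p1 i) (q1 i) ha hb hab
  · have h := key (p2 r) (q2 r)
    simp only [Prod.fst_add, Prod.snd_add, Prod.smul_fst, Prod.smul_snd, frob_add_right,
      frob_smul_right, dotProduct_add, dotProduct_smul, smul_eq_mul]
    linarith
  · exact (mcCormick_affine P i j t hab _ _ _ _).trans_le (key (p3 i j hij t) (q3 i j hij t))
  · exact (triangle_affine P i j k t hab _ _ _ _).trans_le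
      (key (p4 i j k hij hjk t) (q4 i j k hij hjk t))
  · simp [p5 i j hij, q5 i j hij]

lemma isClosed_relaxFeasible_zero : IsClosed (P.relaxFeasible 0) := by
  have h : P.relaxFeasible 0 = {p | _} := Set.ext (mem_relaxFeasible_zero_iff P)
  rw [h]
  simp only [Set.ofPred_and, Set.ofPred_forall]
  refine .inter (isClosed_iInter fun i => .inter ?_ ?_) <| .inter (isClosed_iInter fun r => ?_) <|
    .inter (isClosed_iInter fun i => isClosed_iInter fun j => isClosed_iInter fun _ =>
      isClosed_iInter fun t => ?_) <|
    .inter (isClosed_iInter fun i => isClosed_iInter fun j => isClosed_iInter fun k =>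
      isClosed_iInter fun _ => isClosed_iInter fun _ => isClosed_iInter fun t => ?_) <|
    isClosed_iInter fun i => isClosed_iInter fun j => isClosed_iInter fun _ => ?_
  · exact isClosed_le (by fun_prop) (by fun_prop)
  · exact isClosed_le (by fun_prop) (by fun_prop)
  · exact isClosed_le (((continuous_frob_right _).comp continuous_snd).add
      (continuous_const.dotProduct continuous_fst)) continuous_const
  · exact isClosed_le (continuous_mcCormick P i j t) continuous_const
  · exact isClosed_le (continuous_triangle P i j k t) continuous_const
  · exact isClosed_eq (by fun_prop) (by fun_prop)

/-- The McCormick inequalities confine `Y i j` to the interval `[0, u i * u j]`. -/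
lemma mem_Icc_of_mem_relaxFeasible_zero (hl : ∀ i, 0 ≤ P.l i)
    {p : (Fin n → ℝ) × Matrix (Fin n) (Fin n) ℝ} (hp : p ∈ P.relaxFeasible 0) (i j : Fin n) :
    p.2 i j ∈ Set.Icc 0 (P.u i * P.u j) := by
  obtain ⟨hx, -, hmc, -, hsymm⟩ := hp
  have key : ∀ i j, i ≤ j → p.2 i j ∈ Set.Icc 0 (P.u i * P.u j) := by
    intro i j hij
    have hup := hmc i j hij 0
    have hlow := hmc i j hij 3
    simp only [mcCormick, Matrix.cons_val] at hup hlow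
    obtain ⟨hi1, hi2⟩ := hx i
    obtain ⟨hj1, hj2⟩ := hx j
    have hli := hl i
    have hlj := hl j
    -- The lower bound is `lⱼxᵢ + lᵢ(xⱼ - lⱼ) ≥ 0`; the slack in the upper one is `uⱼ(uᵢ - xᵢ) +
    -- lᵢ(uⱼ - xⱼ)`.
    have hd1 := mul_nonneg hlj (hli.trans hi1)
    have hd2 := mul_nonneg hli (sub_nonneg.mpr hj1)
    have hd3 := mul_nonneg hli (sub_nonneg.mpr hj2)
    have hd4 := mul_nonneg (hlj.trans (hj1.trans hj2)) (sub_nonneg.mpr hi2)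
    constructor <;> linarith
  rcases le_total i j with hij | hij
  · exact key i j hij
  · rw [← (isSymm_of_lt hsymm).apply i j, mul_comm]
    exact key j i hij

lemma isCompact_relaxFeasible_zero (hl : ∀ i, 0 ≤ P.l i) : IsCompact (P.relaxFeasible 0) := by
  have hx : IsCompact (Set.univ.pi fun i => Set.Icc (P.l i) (P.u i)) :=
    isCompact_univ_pi fun _ => isCompact_Icc
  have hY : IsCompact (X := Matrix (Fin n) (Fin n) ℝ)
      (Set.univ.pi fun i => Set.univ.pi fun j => Set.Icc 0 (P.u i * P.u j)) :=
    isCompact_univ_pi fun _ => isCompact_univ_pi fun _ => isCompact_Icc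
  exact (hx.prod hY).of_isClosed_subset P.isClosed_relaxFeasible_zero fun p hp =>
    ⟨fun i _ => hp.1 i, fun i _ j _ => P.mem_Icc_of_mem_relaxFeasible_zero hl hp i j⟩

end RelaxFeasibleZero

/-! ### Convexity in `(x, Y)`, concavity in `S` -/

lemma convex_posSemidef : Convex ℝ {S : Matrix (Fin n) (Fin n) ℝ | S.PosSemidef} :=
  fun _ hA _ hB _ _ ha hb _ => (hA.smul ha).add (hB.smul hb)

lemma convexOn_frob_outer {S : Matrix (Fin n) (Fin n) ℝ} (hS : S.PosSemidef) :
    ConvexOn ℝ Set.univ fun x => frob S (outer x) := by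
  refine ⟨convex_univ, fun x _ y _ a b ha hb hab => ?_⟩
  -- The convexity gap of a quadratic form `q` is `a b q(x - y)`.
  have h := mul_nonneg (mul_nonneg ha hb) (frob_nonneg hS (posSemidef_outer (x - y)))
  obtain rfl : b = 1 - a := by linarith
  simp only [frob_outer_right, Matrix.mulVec_add, Matrix.mulVec_sub, Matrix.mulVec_smul,
    dotProduct_add, add_dotProduct, dotProduct_sub, sub_dotProduct, dotProduct_smul,
    smul_dotProduct, smul_eq_mul] at h ⊢
  linarith

lemma convexOn_convexified (P : QCQP n m) (r : Fin (m + 1)) {S : Matrix (Fin n) (Fin n) ℝ}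
    (hS : S.PosSemidef) {K : Set ((Fin n → ℝ) × Matrix (Fin n) (Fin n) ℝ)} (hK : Convex ℝ K) :
    ConvexOn ℝ K fun p => P.convexified r S p.1 p.2 := by
  refine ⟨hK, fun p _ q _ a b ha hb hab => ?_⟩
  have h := (convexOn_frob_outer hS).2 (Set.mem_univ p.1) (Set.mem_univ q.1) ha hb hab
  simp only [convexified, Prod.fst_add, Prod.snd_add, Prod.smul_fst, Prod.smul_snd,
    frob_add_right, frob_smul_right, dotProduct_add, dotProduct_smul, smul_eq_mul] at h ⊢
  linarith

lemma concaveOn_convexified (P : QCQP n m) (r : Fin (m + 1))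
    (x : Fin n → ℝ) (Y : Matrix (Fin n) (Fin n) ℝ) :
    ConcaveOn ℝ {S : Matrix (Fin n) (Fin n) ℝ | S.PosSemidef}
      fun S => P.convexified r S x Y := by
  refine ⟨convex_posSemidef, fun A _ B _ a b _ _ hab => ?_⟩
  obtain rfl : b = 1 - a := by linarith
  simp only [convexified_eq, frob_add_left, frob_smul_left, smul_eq_mul]
  exact le_of_eq (by ring)

lemma continuous_convexified (P : QCQP n m) (r : Fin (m + 1)) (S : Matrix (Fin n) (Fin n) ℝ) :
    Continuous fun p : (Fin n → ℝ) × Matrix (Fin n) (Fin n) ℝ => P.convexified r S p.1 p.2 :=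
  (((continuous_frob_right S).comp (continuous_outer.comp continuous_fst)).add
    (continuous_const.dotProduct continuous_fst)).add
    ((continuous_frob_right _).comp continuous_snd)

lemma continuous_convexified_matrix (P : QCQP n m) (r : Fin (m + 1))
    (x : Fin n → ℝ) (Y : Matrix (Fin n) (Fin n) ℝ) :
    Continuous fun S => P.convexified r S x Y := by
  simp only [convexified_eq]
  exact continuous_const.sub (continuous_frob_left _)

/-! ### Strong duality -/

/-- Convexifying only the objective function is a special case of `vOPT`. -/
lemma iSup_iInf_convexified_le_vOPT (P : QCQP n m) :
    ⨆ S ∈ {S : Matrix (Fin n) (Fin n) ℝ | S.PosSemidef}, ⨅ p ∈ P.relaxFeasible 0,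
      ((P.convexified 0 S p.1 p.2 : ℝ) : EReal) ≤ P.vOPT := by
  refine iSup₂_le fun S hS => ?_
  refine le_trans ?_ (le_iSup₂ (Fin.cons S fun _ => 0 : Fin (m + 1) → Matrix (Fin n) (Fin n) ℝ) ?_)
  · exact le_of_eq rfl
  · exact Fin.cases hS fun _ => Matrix.PosSemidef.zero

/-- The supremum over all convexifications of the objective penalizes the points that violate
the semidefinite constraint by `⊤`. -/
lemma vSDP_le_iInf_iSup_convexified (P : QCQP n m) :
    P.vSDP ≤ ⨅ p ∈ P.relaxFeasible 0, ⨆ S ∈ {S : Matrix (Fin n) (Fin n) ℝ | S.PosSemidef},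
      ((P.convexified 0 S p.1 p.2 : ℝ) : EReal) := by
  refine le_iInf₂ fun p hp => ?_
  obtain ⟨hx, hc, hmc, htri, hsymm⟩ := (P.mem_relaxFeasible_zero_iff p).mp hp
  have hY := isSymm_of_lt hsymm
  by_cases hpsd : (p.2 - outer p.1).PosSemidef
  · have hfeas : p ∈ P.sdpFeasible := by
      refine ⟨⟨hc, fun i => ?_, fun i => ?_, fun i => ?_,
        (shorMatrix_posSemidef_iff _ _).mpr hpsd, hY⟩, fun i j hij => hmc i j hij.le, htri⟩
      · have h := hmc i i le_rfl 0
        simp only [mcCormick, Matrix.cons_val] at h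
        linarith
      · have h := hmc i i le_rfl 2
        simp only [mcCormick, Matrix.cons_val] at h
        linarith
      · have h := hmc i i le_rfl 3
        simp only [mcCormick, Matrix.cons_val] at h
        linarith
    refine (iInf₂_le p hfeas).trans (le_trans ?_ (le_iSup₂ 0 Matrix.PosSemidef.zero))
    simp [convexified_eq]
  · have hherm : (p.2 - outer p.1).IsHermitian := by
      refine Matrix.IsHermitian.sub ?_ (posSemidef_outer p.1).1
      rwa [Matrix.IsHermitian, Matrix.conjTranspose_eq_transpose_of_trivial]
    obtain ⟨v, hv⟩ : ∃ v, v ⬝ᵥ ((p.2 - outer p.1) *ᵥ v) < 0 := by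
      by_contra! hcon
      exact hpsd (Matrix.PosSemidef.of_dotProduct_mulVec_nonneg hherm
        fun v => by simpa using hcon v)
    rw [← frob_outer_left] at hv
    -- Along the ray `k • outer v` the value is `e - k * d` with `d < 0`, hence unbounded above.
    refine le_trans le_top (top_le_iff.mpr (EReal.eq_top_iff_forall_lt _ |>.mpr fun y => ?_))
    set d := frob (outer v) (p.2 - outer p.1)
    set e := frob (P.Q 0) p.2 + P.c 0 ⬝ᵥ p.1
    obtain ⟨k, hk⟩ := exists_nat_gt ((y - e) / -d)
    rw [div_lt_iff₀ (by linarith)] at hk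
    refine lt_of_lt_of_le ?_ (le_iSup₂ ((k : ℝ) • outer v)
      ((posSemidef_outer v).smul (Nat.cast_nonneg k)))
    rw [EReal.coe_lt_coe_iff, convexified_eq, frob_smul_left]
    linarith

lemma vSDP_le_vOPT (P : QCQP n m) (hl : ∀ i, 0 ≤ P.l i) : P.vSDP ≤ P.vOPT := by
  rcases (P.relaxFeasible 0).eq_empty_or_nonempty with hK | hK
  -- Sion's theorem needs `K` nonempty; for empty `K` the inner infimum is `⊤` already at `S = 0`.
  · refine le_trans ?_ P.iSup_iInf_convexified_le_vOPT
    refine le_trans le_top (le_trans ?_ (le_iSup₂ 0 Matrix.PosSemidef.zero))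
    simp [hK]
  · refine P.vSDP_le_iInf_iSup_convexified.trans (le_trans (le_of_eq ?_)
      P.iSup_iInf_convexified_le_vOPT)
    refine Sion.minimax' hK P.convex_relaxFeasible_zero (P.isCompact_relaxFeasible_zero hl)
      (fun S _ => ?_) (fun S hS => ?_) convex_posSemidef (fun p _ => ?_) (fun p _ => ?_)
    · exact (continuous_coe_real_ereal.comp
        (P.continuous_convexified 0 S)).lowerSemicontinuous.lowerSemicontinuousOn _
    · exact (P.convexOn_convexified 0 hS P.convex_relaxFeasible_zero).quasiconvexOn.monotone_comp
        (g := Real.toEReal) EReal.coe_strictMono.monotone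
    · exact (continuous_coe_real_ereal.comp
        (P.continuous_convexified_matrix 0 p.1 p.2)).upperSemicontinuous.upperSemicontinuousOn _
    · exact (P.concaveOn_convexified 0 p.1 p.2).quasiconcaveOn.monotone_comp
        (g := Real.toEReal) EReal.coe_strictMono.monotone

end QCQP

theorem theorem1 {n m : ℕ} (P : QCQP n m)
    (hQ : ∀ r, (P.Q r).IsSymm)
    (hl : ∀ i, 0 ≤ P.l i)
    (hP : P.feasible.Nonempty) :
    P.vOPT = P.vSDP :=
  le_antisymm (P.vOPT_le_vSDP hP) (P.vSDP_le_vOPT hl)
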